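/- Let $\mathbb{T}=\mathbb{R}/2\pi\mathbb{Z}$ with the measure $d\theta$, and let $\log^+ t=\max\{\log t,0\}$ for $t>0$, $\log^+0=0$. Let $L\log\log L(\mathbb{T})$ be the class of all integrable functions $f:\mathbb{T}\to\mathbb{C}$ with $$\int_{\mathbb{T}}|f(\theta)|\,\log^+\log^+|f(\theta)|\,d\theta<\infty .$$ For $0<r<1$ let $$P_r(\theta)=\frac{1-r^2}{1-2r\cos\theta+r^2},\qquad (P_r*f)(\theta)=\frac1{2\pi}\int_{\mathbb{T}}P_r(\varphi)f(\theta-\varphi)\,d\varphi ,$$ and let $\Psi_0(t)=t/\log(e+t)$ for $0\le t<\infty$, $\Psi_0(\infty)=\infty$. Let $H^{\log}(\mathbb{T})$ be the class of all measurable functions $f:\mathbb{T}\to\mathbb{C}$ for which the integrals defining $P_r*f$ converge absolutely for all $0<r<1$ and all $\theta$ (equivalently, $f$ is integrable), and $$\int_{\mathbb{T}}\Psi_0\Big(\sup_{0<r<1}|(P_r*f)(\theta)|\Big)\,d\theta<\infty .$$ Then $$\{f\in L\log\log L(\mathbb{T}) : f\ge 0 \text{ a.e. on } \mathbb{T}\}=\{f\in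 H^{\log}(\mathbb{T}) : f\ge 0 \text{ a.e. on } \mathbb{T}\}.$$ -/

import Mathlib

open MeasureTheory Set
open scoped Real ENNReal Convolution ComplexOrder

noncomputable section

namespace HardyLog

instance factTwoPiPos : Fact (0 < 2 * π) := ⟨Real.two_pi_pos⟩

/-- The torus `ℝ / 2πℤ`; its `volume` is arc length `dθ`, of total mass `2π`. -/
abbrev Torus : Type := AddCircle (2 * π)

/-- The cosine as a function on the torus. -/
def torusCos : Torus → ℝ := Real.cos_periodic.lift

theorem torusCos_coe (x : ℝ) : torusCos (x : Torus) = Real.cos x := rfl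

/-- The Poisson kernel of the unit disk, `P_r(θ) = (1 - r²) / (1 - 2 r cos θ + r²)`. -/
def diskPoisson (r : ℝ) (θ : Torus) : ℝ :=
  (1 - r ^ 2) / (1 - 2 * r * torusCos θ + r ^ 2)

/-- The convolution `P_r * f` on the torus,
`(P_r * f)(θ) = (2π)⁻¹ ∫ P_r(φ) f(θ - φ) dφ`. -/
def poissonConv (r : ℝ) (f : Torus → ℂ) (θ : Torus) : ℂ :=
  (2 * π)⁻¹ • (diskPoisson r ⋆[ContinuousLinearMap.lsmul ℝ ℝ] f) θ

/-- The Poisson maximal function `sup_{0 < r < 1} |P_r * f (θ)|`, with values in `[0, ∞]`. -/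
def poissonMax (f : Torus → ℂ) (θ : Torus) : ℝ≥0∞ :=
  ⨆ r ∈ Ioo (0 : ℝ) 1, ‖poissonConv r f θ‖ₑ

/-- The function `Ψ₀(t) = t / log (e + t)` for `t ≥ 0`, extended by its limit `Ψ₀(∞) = ∞`. -/
def psiZero (t : ℝ≥0∞) : ℝ≥0∞ :=
  if t = ∞ then ∞ else ENNReal.ofReal (t.toReal / Real.log (Real.exp 1 + t.toReal))

/-- The class `L log log L (𝕋)`: integrable `f` with `∫ |f| log⁺ log⁺ |f| dθ < ∞`. -/
def LLogLogL : Set (Torus → ℂ) :=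
  {f | Integrable f ∧
    ∫⁻ θ, ENNReal.ofReal (‖f θ‖ * Real.posLog (Real.posLog ‖f θ‖)) < ∞}

/-- The class `H^log (𝕋)`: measurable `f` for which the convolutions `P_r * f`, `0 < r < 1`,
are given by convergent integrals (so that `P_r * f` is not a junk value) and
`∫ Ψ₀ (sup_{0 < r < 1} |P_r * f|) dθ < ∞`. -/
def HLog : Set (Torus → ℂ) :=
  {f | AEStronglyMeasurable f ∧
    (∀ r ∈ Ioo (0 : ℝ) 1,
      ConvolutionExists (diskPoisson r) f (ContinuousLinearMap.lsmul ℝ ℝ) volume) ∧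
    ∫⁻ θ, psiZero (poissonMax f θ) < ∞}

end HardyLog

end

/-! Write `Mf` for the Poisson maximal function and `ν` for the measure `|f| dθ`. The proof shows
that the distribution function of `Mf` and the `ν`-measure of the level sets of `|f|` determine each
other up to constants. In one direction the weak type (1,1) bound, applied to the part of `f` above
a multiple of `t`, gives `t |{Mf > t}| ≲ ν{|f| > ct}`. In the other, a Vitali covering with nearly
maximal radii gives, for large `t`, `ν{|f| > t} ≲ t |{Mf > ct}|`. Both are proved for averages over
balls. The Poisson kernel is dominated by a geometric sum of averages, and it dominates the average
over the ball of radius `1 - r`. Only the latter bound needs `f ≥ 0`, which excludes cancellation in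
`P_r * f`.

The two classes match because `Ψ₀'(t)` and `t (log log (e + t))'` are both comparable to `1 / log (e
+ t)`, away from `t = 0`. By the layer cake formula `∫ Ψ₀(Mf) dθ = ∫ |{Mf > t}| Ψ₀'(t) dt`, which is
then comparable to `∫ ν{|f| > t} (log log (e + t))' dt = ∫ |f| log log (e + |f|) dθ`. Small `t`
contribute a finite amount, since both measures are finite. -/

namespace HardyLog

open Metric Filter Topology

/-! ### Covering and maximal inequalities on the circle -/

/-- A Vitali covering lemma for closed balls centred at the points of a set. -/
theorem exists_countable_disjoint_closedBall {X : Type*} [PseudoMetricSpace X]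
    [TopologicalSpace.SeparableSpace X] (S : Set X) (ρ : X → ℝ) (R : ℝ)
    (hpos : ∀ x ∈ S, 0 < ρ x) (hR : ∀ x ∈ S, ρ x ≤ R) :
    ∃ D ⊆ S, D.Countable ∧ D.PairwiseDisjoint (fun x => closedBall x (ρ x)) ∧
      S ⊆ ⋃ x ∈ D, closedBall x (5 * ρ x) := by
  obtain ⟨D, hDS, hdisj, hcov⟩ := Vitali.exists_disjoint_subfamily_covering_enlargement_closedBall
    S id ρ R hR 5 (by norm_num)
  refine ⟨D, hDS, ?_, hdisj, ?_⟩
  · refine hdisj.countable_of_nonempty_interior fun x hx => ?_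
    exact ⟨x, ball_subset_interior_closedBall (mem_ball_self (hpos x (hDS hx)))⟩
  · intro x hx
    obtain ⟨b, hb, hsub⟩ := hcov x hx
    exact mem_biUnion hb (hsub (mem_closedBall_self (hpos x hx).le))

/-- A ball cannot carry more than the total mass. This supplies the bounded radii required by the
Vitali lemma. -/
theorem two_mul_lt_of_lt_measure {T : ℝ} {ν : Measure (AddCircle T)} {lam δ ρ : ℝ} (hlam : 0 < lam)
    (hδ : ν univ ≤ ENNReal.ofReal (lam * δ)) {x : AddCircle T}
    (h : ENNReal.ofReal (lam * (2 * ρ)) < ν (closedBall x ρ)) : 2 * ρ < δ := by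
  have h1 := h.trans_le ((measure_mono (subset_univ _)).trans hδ)
  have h2 := lt_of_not_ge fun h' => h1.not_ge (ENNReal.ofReal_le_ofReal h')
  exact lt_of_mul_lt_mul_left h2 hlam.le

section

variable {T : ℝ} [hT : Fact (0 < T)]

theorem addCircle_volume_closedBall_le (x : AddCircle T) (ε : ℝ) :
    volume (closedBall x ε) ≤ ENNReal.ofReal (2 * ε) := by
  rw [AddCircle.volume_closedBall]
  exact ENNReal.ofReal_le_ofReal (min_le_right _ _)

/-- The weak type (1,1) inequality for the maximal function of a finite measure. -/
theorem volume_maximal_gt_mul_le (ν : Measure (AddCircle T)) [IsFiniteMeasure ν] {lam : ℝ}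
    (hlam : 0 < lam) :
    volume {x | ∃ ρ > 0, ENNReal.ofReal (lam * (2 * ρ)) < ν (closedBall x ρ)} *
      ENNReal.ofReal lam ≤ 5 * ν univ := by
  set S := {x | ∃ ρ > 0, ENNReal.ofReal (lam * (2 * ρ)) < ν (closedBall x ρ)} with hS
  choose! ρ hρ0 hρ using fun x (hx : x ∈ S) => hx
  have hδ : ν univ ≤ ENNReal.ofReal (lam * (ν.real univ / lam)) := by
    rw [mul_div_cancel₀ _ hlam.ne', ofReal_measureReal]
  obtain ⟨D, hDS, hDc, hdisj, hcov⟩ := exists_countable_disjoint_closedBall S ρ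
    (ν.real univ / lam) hρ0 fun x hx => by
      have := two_mul_lt_of_lt_measure hlam hδ (hρ x hx)
      linarith [hρ0 x hx]
  have : Countable D := hDc
  calc volume S * ENNReal.ofReal lam
      ≤ (∑' x : D, volume (closedBall (x : AddCircle T) (5 * ρ x))) * ENNReal.ofReal lam := by
        gcongr
        exact (measure_mono hcov).trans (measure_biUnion_le _ hDc _)
    _ = ∑' x : D, volume (closedBall (x : AddCircle T) (5 * ρ x)) * ENNReal.ofReal lam :=
        ENNReal.tsum_mul_right.symm
    _ ≤ ∑' x : D, 5 * ν (closedBall (x : AddCircle T) (ρ x)) := by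
        refine ENNReal.tsum_le_tsum fun x => ?_
        have h0 := hρ0 x (hDS x.2)
        calc volume (closedBall (x : AddCircle T) (5 * ρ x)) * ENNReal.ofReal lam
            ≤ ENNReal.ofReal (2 * (5 * ρ x)) * ENNReal.ofReal lam := by
              gcongr
              exact addCircle_volume_closedBall_le _ _
          _ = 5 * ENNReal.ofReal (lam * (2 * ρ x)) := by
              rw [← ENNReal.ofReal_mul (by positivity),
                show (5 : ℝ≥0∞) = ENNReal.ofReal 5 by norm_num,
                ← ENNReal.ofReal_mul (by norm_num)]
              ring_nf
          _ ≤ _ := by gcongr; exact (hρ x (hDS x.2)).le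
    _ = 5 * ν (⋃ x ∈ D, closedBall (x : AddCircle T) (ρ x)) := by
        rw [ENNReal.tsum_mul_left, measure_biUnion hDc hdisj fun x _ => measurableSet_closedBall]
    _ ≤ 5 * ν univ := by gcongr; exact subset_univ _

/-- The weak type inequality in which only the large values of the function are integrated. -/
theorem volume_maximal_gt_mul_le_setLIntegral {u : AddCircle T → ℝ≥0∞} (hu : Measurable u)
    (hfin : ∫⁻ x, u x ≠ ∞) {lam : ℝ} (hlam : 0 < lam) :
    volume {x | ∃ ρ > 0, ENNReal.ofReal (lam * (2 * ρ)) < ∫⁻ y in closedBall x ρ, u y} *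
      ENNReal.ofReal lam ≤ 10 * ∫⁻ x in {x | ENNReal.ofReal (lam / 2) < u x}, u x := by
  set A := {x | ENNReal.ofReal (lam / 2) < u x} with hA
  have hAm : MeasurableSet A := measurableSet_lt measurable_const hu
  set ν : Measure (AddCircle T) := volume.withDensity (A.indicator u) with hν
  have hνu : ν univ = ∫⁻ x in A, u x := by
    rw [hν, withDensity_apply _ MeasurableSet.univ, Measure.restrict_univ, lintegral_indicator hAm]
  have hνfin : IsFiniteMeasure ν := ⟨by
    rw [hνu]
    exact (setLIntegral_le_lintegral _ _).trans_lt hfin.lt_top⟩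
  -- The part of `u` below `lam / 2` contributes at most half of `lam * (2 * ρ)` on a ball of radius
  -- `ρ`, so the large part carries the other half.
  have hle : ∀ y, u y ≤ A.indicator u y + ENNReal.ofReal (lam / 2) := by
    intro y
    by_cases hy : y ∈ A
    · simp [hy]
    · simp only [hy, not_false_eq_true, indicator_of_notMem, zero_add]
      exact not_lt.1 hy
  have key : {x | ∃ ρ > 0, ENNReal.ofReal (lam * (2 * ρ)) < ∫⁻ y in closedBall x ρ, u y} ⊆
      {x | ∃ ρ > 0, ENNReal.ofReal (lam / 2 * (2 * ρ)) < ν (closedBall x ρ)} := by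
    rintro x ⟨ρ, hρ0, hρ⟩
    refine ⟨ρ, hρ0, ?_⟩
    have h1 : ∫⁻ y in closedBall x ρ, u y ≤
        ν (closedBall x ρ) + ENNReal.ofReal (lam / 2 * (2 * ρ)) := by
      calc ∫⁻ y in closedBall x ρ, u y
          ≤ ∫⁻ y in closedBall x ρ, (A.indicator u y + ENNReal.ofReal (lam / 2)) :=
            lintegral_mono hle
        _ = ν (closedBall x ρ) + ENNReal.ofReal (lam / 2) * volume (closedBall x ρ) := by
            rw [lintegral_add_right _ measurable_const, setLIntegral_const, hν,
              withDensity_apply _ measurableSet_closedBall]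
        _ ≤ _ := by
            rw [ENNReal.ofReal_mul (by positivity)]
            gcongr
            exact addCircle_volume_closedBall_le _ _
    have h2 := hρ.trans_le h1
    rw [show lam * (2 * ρ) = lam / 2 * (2 * ρ) + lam / 2 * (2 * ρ) by ring,
      ENNReal.ofReal_add (by positivity) (by positivity)] at h2
    exact lt_of_add_lt_add_right h2
  have h := volume_maximal_gt_mul_le ν (half_pos hlam)
  calc _ ≤ volume {x | ∃ ρ > 0, ENNReal.ofReal (lam / 2 * (2 * ρ)) < ν (closedBall x ρ)} *
        ENNReal.ofReal (2 * (lam / 2)) := by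
          rw [mul_div_cancel₀ _ two_ne_zero]
          gcongr
    _ = 2 * (volume {x | ∃ ρ > 0, ENNReal.ofReal (lam / 2 * (2 * ρ)) < ν (closedBall x ρ)} *
        ENNReal.ofReal (lam / 2)) := by
          rw [ENNReal.ofReal_mul (by norm_num), ENNReal.ofReal_ofNat]; ring
    _ ≤ 2 * (5 * ν univ) := by gcongr
    _ = _ := by rw [hνu, ← mul_assoc]; norm_num

/-- The converse of the weak type inequality. -/
theorem withDensity_gt_le_mul_volume {u : AddCircle T → ℝ≥0∞} (hu : Measurable u)
    (hfin : ∫⁻ x, u x ≠ ∞) {lam δ : ℝ} (hlam : 0 < lam) (hδT : δ ≤ T)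
    (hδ : ∫⁻ x, u x ≤ ENNReal.ofReal (lam * δ)) :
    volume.withDensity u {x | ENNReal.ofReal lam < u x} ≤ ENNReal.ofReal (5 * lam) *
      volume {y | ∃ ρ ∈ Ioo 0 δ, ENNReal.ofReal (lam * ρ) < ∫⁻ z in closedBall y ρ, u z} := by
  set E := {y | ∃ ρ ∈ Ioo 0 δ, ENNReal.ofReal (lam * ρ) < ∫⁻ z in closedBall y ρ, u z} with hE
  set ν : Measure (AddCircle T) := volume.withDensity u with hν
  have hνb : ∀ x ρ, ν (closedBall x ρ) = ∫⁻ z in closedBall x ρ, u z := fun x ρ =>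
    withDensity_apply _ measurableSet_closedBall
  have hδ' : ν univ ≤ ENNReal.ofReal (lam * δ) := by
    rwa [hν, withDensity_apply _ MeasurableSet.univ, Measure.restrict_univ]
  set S := {x | ∃ ρ > 0, ENNReal.ofReal (lam * (2 * ρ)) < ν (closedBall x ρ)} with hS
  -- Lebesgue differentiation: almost everywhere on `{u > lam}`, averages over small balls exceed
  -- `lam`. Radii below `T / 2` make the volume exactly `2 * ρ`.
  have hae : ∀ᵐ x : AddCircle T, ENNReal.ofReal lam < u x → x ∈ S := by
    filter_upwards [(IsUnifLocDoublingMeasure.vitaliFamily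
      (volume : Measure (AddCircle T)) 1).ae_tendsto_lintegral_div hu.aemeasurable hfin]
      with x hx hlt
    have hlim := hx.comp (IsUnifLocDoublingMeasure.tendsto_closedBall_filterAt
      (volume : Measure (AddCircle T)) (K := 1) (x := x) (l := 𝓝[>] (0 : ℝ)) (fun _ => x) id
      tendsto_id (by
        filter_upwards [self_mem_nhdsWithin] with ρ hρ
        exact mem_closedBall_self (by simpa using le_of_lt hρ)))
    have hev := (hlim.eventually (lt_mem_nhds hlt)).and
      (Ioo_mem_nhdsGT (half_pos hT.out))
    obtain ⟨ρ, h1, h2⟩ := hev.exists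
    refine ⟨ρ, h2.1, ?_⟩
    simp only [Function.comp, id] at h1
    have hv : volume (closedBall x ρ) = ENNReal.ofReal (2 * ρ) := by
      rw [AddCircle.volume_closedBall, min_eq_right (by linarith [h2.2])]
    rw [hv, ENNReal.lt_div_iff_mul_lt (Or.inr (by simp))
      (Or.inr (by simpa using hlam)), ← ENNReal.ofReal_mul hlam.le] at h1
    rwa [hνb]
  -- A radius above half the supremum of the admissible ones: then `5 * ρ` is no longer admissible,
  -- which bounds the mass of the enlarged ball from above.
  have hrad : ∀ x ∈ S, ∃ ρ > 0, ENNReal.ofReal (lam * (2 * ρ)) < ν (closedBall x ρ) ∧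
      ν (closedBall x (5 * ρ)) ≤ ENNReal.ofReal (lam * (2 * (5 * ρ))) := by
    intro x hx
    set A := {ρ | 0 < ρ ∧ ENNReal.ofReal (lam * (2 * ρ)) < ν (closedBall x ρ)} with hA
    have hbdd : BddAbove A := ⟨δ, fun ρ hρ => by
      have := two_mul_lt_of_lt_measure hlam hδ' hρ.2
      linarith [hρ.1]⟩
    obtain ⟨ρ₀, hρ₀⟩ := hx
    have hs : 0 < sSup A := lt_of_lt_of_le hρ₀.1 (le_csSup hbdd hρ₀)
    obtain ⟨ρ, hρA, hρ⟩ := exists_lt_of_lt_csSup ⟨ρ₀, hρ₀⟩ (half_lt_self hs)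
    refine ⟨ρ, hρA.1, hρA.2, le_of_not_gt fun h => ?_⟩
    have := le_csSup hbdd (show 5 * ρ ∈ A from ⟨by linarith [hρA.1], h⟩)
    linarith
  choose! ρ hρ0 hρ hρ5 using hrad
  obtain ⟨D, hDS, hDc, hdisj, hcov⟩ := exists_countable_disjoint_closedBall S ρ δ hρ0
    fun x hx => by
      have := two_mul_lt_of_lt_measure hlam hδ' (hρ x hx)
      linarith [hρ0 x hx]
  have hsub : (⋃ x ∈ D, closedBall x (ρ x)) ⊆ E := by
    refine iUnion₂_subset fun x hx y hy => ?_
    -- The ball of radius `2 * ρ x` about `y` contains the selected ball. Doubling the radius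
    -- accounts for `lam * ρ` in `E` where `S` has `lam * (2 * ρ)`.
    refine ⟨2 * ρ x, ⟨by linarith [hρ0 x (hDS hx)],
      two_mul_lt_of_lt_measure hlam hδ' (hρ x (hDS hx))⟩, ?_⟩
    rw [← hνb]
    refine (hρ x (hDS hx)).trans_le (measure_mono (closedBall_subset_closedBall' ?_))
    rw [mem_closedBall'] at hy
    linarith
  calc ν {x | ENNReal.ofReal lam < u x}
      ≤ ν S := measure_mono_ae ((withDensity_absolutelyContinuous _ _).ae_le hae)
    _ ≤ ∑' x : D, ν (closedBall (x : AddCircle T) (5 * ρ x)) :=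
        (measure_mono hcov).trans (measure_biUnion_le _ hDc _)
    _ ≤ ∑' x : D, ENNReal.ofReal (5 * lam) * volume (closedBall (x : AddCircle T) (ρ x)) := by
        refine ENNReal.tsum_le_tsum fun x => (hρ5 x (hDS x.2)).trans_eq ?_
        have h2 := two_mul_lt_of_lt_measure hlam hδ' (hρ x (hDS x.2))
        rw [AddCircle.volume_closedBall, min_eq_right (by linarith),
          ← ENNReal.ofReal_mul (by positivity)]
        ring_nf
    _ = ENNReal.ofReal (5 * lam) * volume (⋃ x ∈ D, closedBall (x : AddCircle T) (ρ x)) := by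
        rw [ENNReal.tsum_mul_left, measure_biUnion hDc hdisj fun x _ => measurableSet_closedBall]
    _ ≤ _ := by gcongr

end

/-! ### Cosine and norm on the torus -/

theorem exists_coe_eq_abs_eq_norm (θ : Torus) : ∃ x : ℝ, (x : Torus) = θ ∧ |x| = ‖θ‖ ∧ |x| ≤ π := by
  have hx := (AddCircle.equivIoc (2 * π) (-π) θ).2
  set x : ℝ := (AddCircle.equivIoc (2 * π) (-π) θ : ℝ) with hxdef
  have hθ : (x : Torus) = θ := AddCircle.coe_equivIoc
  have habs : |x| ≤ π := abs_le.2 ⟨hx.1.le, by linarith [hx.2]⟩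
  refine ⟨x, hθ, ?_, habs⟩
  rw [← hθ]
  refine ((AddCircle.norm_coe_eq_abs_iff (2 * π) Real.two_pi_pos.ne').2 ?_).symm
  rw [abs_of_pos Real.two_pi_pos]
  linarith

theorem continuous_torusCos : Continuous torusCos :=
  Real.continuous_cos.quotient_lift _

theorem torusCos_le_one (θ : Torus) : torusCos θ ≤ 1 := by
  obtain ⟨x, rfl, -⟩ := exists_coe_eq_abs_eq_norm θ
  exact Real.cos_le_one x

theorem neg_one_le_torusCos (θ : Torus) : -1 ≤ torusCos θ := by
  obtain ⟨x, rfl, -⟩ := exists_coe_eq_abs_eq_norm θ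
  exact Real.neg_one_le_cos x

theorem one_sub_norm_sq_le_torusCos (θ : Torus) : 1 - ‖θ‖ ^ 2 / 2 ≤ torusCos θ := by
  obtain ⟨x, rfl, hx, -⟩ := exists_coe_eq_abs_eq_norm θ
  rw [← hx, sq_abs]
  exact Real.one_sub_sq_div_two_le_cos

theorem torusCos_le_one_sub_norm_sq (θ : Torus) : torusCos θ ≤ 1 - 2 / π ^ 2 * ‖θ‖ ^ 2 := by
  obtain ⟨x, rfl, hx, hπ⟩ := exists_coe_eq_abs_eq_norm θ
  rw [← hx, sq_abs]
  exact Real.cos_le_one_sub_mul_cos_sq hπ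

theorem norm_torus_le_pi (θ : Torus) : ‖θ‖ ≤ π := by
  obtain ⟨x, rfl, hx, hπ⟩ := exists_coe_eq_abs_eq_norm θ
  rwa [← hx]

/-! ### Poisson kernel estimates and comparison with averages over balls -/

section Poisson

variable {r : ℝ}

theorem one_sub_sq_le_poisson_denom (hr : r ∈ Ioo (0 : ℝ) 1) (θ : Torus) :
    (1 - r) ^ 2 ≤ 1 - 2 * r * torusCos θ + r ^ 2 := by
  nlinarith [torusCos_le_one θ, hr.1]

theorem poisson_denom_pos (hr : r ∈ Ioo (0 : ℝ) 1) (θ : Torus) :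
    0 < 1 - 2 * r * torusCos θ + r ^ 2 :=
  (pow_pos (sub_pos.2 hr.2) 2).trans_le (one_sub_sq_le_poisson_denom hr θ)

theorem diskPoisson_nonneg (hr : r ∈ Ioo (0 : ℝ) 1) (θ : Torus) : 0 ≤ diskPoisson r θ :=
  div_nonneg (by nlinarith [hr.1, hr.2]) (poisson_denom_pos hr θ).le

theorem continuous_diskPoisson (hr : r ∈ Ioo (0 : ℝ) 1) : Continuous (diskPoisson r) := by
  have := continuous_torusCos
  unfold diskPoisson
  exact Continuous.div (by fun_prop) (by fun_prop) fun θ => (poisson_denom_pos hr θ).ne'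

theorem diskPoisson_le (hr : r ∈ Ioo (0 : ℝ) 1) (θ : Torus) : diskPoisson r θ ≤ 2 / (1 - r) := by
  have h1 : 0 < 1 - r := sub_pos.2 hr.2
  rw [diskPoisson, div_le_div_iff₀ (poisson_denom_pos hr θ) h1]
  nlinarith [one_sub_sq_le_poisson_denom hr θ, hr.1, mul_pos h1 h1]

theorem diskPoisson_mul_norm_sq_le (hr : r ∈ Ioo (0 : ℝ) 1) (θ : Torus) :
    diskPoisson r θ * ‖θ‖ ^ 2 ≤ 8 * π ^ 2 * (1 - r) := by
  have h1 : 0 < 1 - r := sub_pos.2 hr.2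
  have hπ := Real.pi_pos
  have hden : ‖θ‖ ^ 2 ≤ 4 * π ^ 2 * (1 - 2 * r * torusCos θ + r ^ 2) := by
    -- The denominator is `(1 - r)² + 2r(1 - cos θ)`. For `r ≤ 1/2` the first term suffices, as `‖θ‖
    -- ≤ π`; for `r ≥ 1/2` the second does, as `1 - cos θ ≥ 2‖θ‖² / π²`.
    rcases le_total r (1 / 2) with h | h
    · have h2 := one_sub_sq_le_poisson_denom hr θ
      have h3 : 1 / 4 ≤ 1 - 2 * r * torusCos θ + r ^ 2 := by nlinarith
      have h4 : ‖θ‖ ^ 2 ≤ π ^ 2 := pow_le_pow_left₀ (norm_nonneg _) (norm_torus_le_pi θ) 2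
      nlinarith [pow_pos hπ 2]
    · have h2 := torusCos_le_one_sub_norm_sq θ
      have h3 : 2 / π ^ 2 * ‖θ‖ ^ 2 ≤ 1 - 2 * r * torusCos θ + r ^ 2 := by
        have : 0 ≤ 2 / π ^ 2 * ‖θ‖ ^ 2 := by positivity
        nlinarith [sq_nonneg (1 - r)]
      have h4 : π ^ 2 * (2 / π ^ 2 * ‖θ‖ ^ 2) = 2 * ‖θ‖ ^ 2 := by field_simp
      nlinarith [mul_le_mul_of_nonneg_left h3 (pow_pos hπ 2).le, sq_nonneg ‖θ‖]
  have hd := poisson_denom_pos hr θ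
  rw [diskPoisson, div_mul_eq_mul_div, div_le_iff₀ hd]
  calc (1 - r ^ 2) * ‖θ‖ ^ 2 ≤ 2 * (1 - r) *
        (4 * π ^ 2 * (1 - 2 * r * torusCos θ + r ^ 2)) := by
        refine mul_le_mul ?_ hden (by positivity) (by linarith)
        nlinarith [hr.1]
    _ = _ := by ring

theorem inv_le_diskPoisson (hr : r ∈ Ioo (0 : ℝ) 1) {θ : Torus} (hθ : ‖θ‖ ≤ 1 - r) :
    1 / (2 * (1 - r)) ≤ diskPoisson r θ := by
  have h1 : 0 < 1 - r := sub_pos.2 hr.2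
  rw [diskPoisson, div_le_div_iff₀ (by linarith) (poisson_denom_pos hr θ)]
  have h2 := one_sub_norm_sq_le_torusCos θ
  have h3 : ‖θ‖ ^ 2 ≤ (1 - r) ^ 2 := pow_le_pow_left₀ (norm_nonneg _) hθ 2
  have h4 : 1 - 2 * r * torusCos θ + r ^ 2 ≤ 2 * (1 - r) ^ 2 := by
    nlinarith [hr.1, sq_nonneg (1 - r)]
  nlinarith [hr.1, mul_pos h1 h1]

/-- The minimum of the kernel is at `cos θ = -1`. Its positivity lets integrability of `f` be
recovered from convergence of the convolution integral. -/
theorem div_le_diskPoisson (hr : r ∈ Ioo (0 : ℝ) 1) (θ : Torus) :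
    (1 - r) / (1 + r) ≤ diskPoisson r θ := by
  have h1 : 0 < 1 - r := sub_pos.2 hr.2
  rw [diskPoisson, div_le_div_iff₀ (by linarith [hr.1]) (poisson_denom_pos hr θ)]
  have h2 : 1 - 2 * r * torusCos θ + r ^ 2 ≤ (1 + r) ^ 2 := by
    nlinarith [neg_one_le_torusCos θ, hr.1]
  nlinarith

/-- The Poisson kernel is dominated by a combination of normalized indicators of balls. -/
theorem ofReal_diskPoisson_sub_le_tsum (hr : r ∈ Ioo (0 : ℝ) 1) (θ ψ : Torus) :
    ENNReal.ofReal (diskPoisson r (θ - ψ)) ≤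
      ∑' k : ℕ, (closedBall θ (2 ^ k * (1 - r))).indicator
        (fun _ => ENNReal.ofReal (32 * π ^ 2 / (4 ^ k * (1 - r)))) ψ := by
  have h1 : 0 < 1 - r := sub_pos.2 hr.2
  have hπ : 1 < π ^ 2 := by nlinarith [Real.pi_gt_three]
  -- With the least such `k`, a single term of the sum suffices. For `k > 0` the distance exceeds
  -- `2^(k-1) (1 - r)`, and quadratic decay gives `8π² · 4 / (4^k (1 - r))`.
  have hex : ∃ k : ℕ, ‖θ - ψ‖ ≤ 2 ^ k * (1 - r) := by
    obtain ⟨k, hk⟩ := pow_unbounded_of_one_lt (‖θ - ψ‖ / (1 - r)) (one_lt_two (α := ℝ))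
    exact ⟨k, ((div_lt_iff₀ h1).1 hk).le⟩
  classical
  obtain ⟨hk, hmin⟩ := And.intro (Nat.find_spec hex) fun m => Nat.find_min hex (m := m)
  generalize Nat.find hex = k at hk hmin
  refine le_trans ?_ (ENNReal.le_tsum k)
  rw [indicator_of_mem (by rwa [mem_closedBall', dist_eq_norm])]
  refine ENNReal.ofReal_le_ofReal ?_
  rcases k with _ | k
  · refine (diskPoisson_le hr _).trans ?_
    rw [pow_zero, one_mul]
    gcongr
    linarith
  · have hlt : 2 ^ k * (1 - r) < ‖θ - ψ‖ := not_le.1 (hmin k (Nat.lt_succ_self k))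
    have hpos : 0 < 2 ^ k * (1 - r) := by positivity
    have h2 : (2 ^ k * (1 - r)) ^ 2 ≤ ‖θ - ψ‖ ^ 2 := pow_le_pow_left₀ hpos.le hlt.le 2
    have h3 : diskPoisson r (θ - ψ) * (2 ^ k * (1 - r)) ^ 2 ≤ 8 * π ^ 2 * (1 - r) :=
      (mul_le_mul_of_nonneg_left h2 (diskPoisson_nonneg hr _)).trans
        (diskPoisson_mul_norm_sq_le hr _)
    rw [le_div_iff₀ (by positivity)]
    have h4 : ((2 : ℝ) ^ k) ^ 2 = 4 ^ k := by rw [← pow_mul, mul_comm, pow_mul]; norm_num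
    rw [mul_pow, h4] at h3
    have h5 : (diskPoisson r (θ - ψ) * (4 ^ (k + 1) * (1 - r))) * (1 - r) ≤
        (32 * π ^ 2) * (1 - r) := by
      rw [pow_succ]; linarith
    exact le_of_mul_le_mul_right h5 h1

/-- The Poisson integral is controlled by the averages over balls. -/
theorem lintegral_diskPoisson_le (hr : r ∈ Ioo (0 : ℝ) 1) {u : Torus → ℝ≥0∞} (hu : Measurable u)
    {lam : ℝ} (hlam : 0 ≤ lam) {θ : Torus}
    (h : ∀ ρ > 0, ∫⁻ ψ in closedBall θ ρ, u ψ ≤ ENNReal.ofReal (lam * (2 * ρ))) :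
    ∫⁻ ψ, ENNReal.ofReal (diskPoisson r (θ - ψ)) * u ψ ≤ ENNReal.ofReal (128 * π ^ 2 * lam) := by
  have h1 : 0 < 1 - r := sub_pos.2 hr.2
  calc ∫⁻ ψ, ENNReal.ofReal (diskPoisson r (θ - ψ)) * u ψ
      ≤ ∫⁻ ψ, ∑' k : ℕ, (closedBall θ (2 ^ k * (1 - r))).indicator
        (fun ψ => ENNReal.ofReal (32 * π ^ 2 / (4 ^ k * (1 - r))) * u ψ) ψ := by
        refine lintegral_mono fun ψ => ?_
        refine (mul_le_mul_left (ofReal_diskPoisson_sub_le_tsum hr θ ψ) _).trans_eq ?_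
        rw [← ENNReal.tsum_mul_right]
        refine tsum_congr fun k => ?_
        by_cases hψ : ψ ∈ closedBall θ (2 ^ k * (1 - r)) <;> simp only [hψ, indicator_of_mem,
          indicator_of_notMem, not_false_eq_true, zero_mul]
    _ = ∑' k : ℕ, ENNReal.ofReal (32 * π ^ 2 / (4 ^ k * (1 - r))) *
          ∫⁻ ψ in closedBall θ (2 ^ k * (1 - r)), u ψ := by
        rw [lintegral_tsum fun k =>
          ((hu.const_mul _).indicator measurableSet_closedBall).aemeasurable]
        refine tsum_congr fun k => ?_
        rw [lintegral_indicator measurableSet_closedBall, lintegral_const_mul _ hu]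
    _ ≤ ∑' k : ℕ, ENNReal.ofReal (64 * π ^ 2 * lam * (1 / 2) ^ k) := by
        refine ENNReal.tsum_le_tsum fun k => ?_
        refine (mul_le_mul_right (h _ (by positivity)) _).trans_eq ?_
        rw [← ENNReal.ofReal_mul (by positivity)]
        congr 1
        have : (4 : ℝ) ^ k = 2 ^ k * 2 ^ k := by rw [← mul_pow]; norm_num
        rw [this, one_div, inv_pow]
        field_simp
        ring
    _ = ENNReal.ofReal (128 * π ^ 2 * lam) := by
        rw [← ENNReal.ofReal_tsum_of_nonneg (fun k => by positivity)
          (summable_geometric_two.mul_left _), tsum_mul_left, tsum_geometric_two]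
        ring_nf

/-- Balls of radius `1 - r` bound the Poisson integral from below. -/
theorem setLIntegral_le_lintegral_diskPoisson (hr : r ∈ Ioo (0 : ℝ) 1) (u : Torus → ℝ≥0∞)
    (θ : Torus) :
    ENNReal.ofReal (1 / (2 * (1 - r))) * ∫⁻ ψ in closedBall θ (1 - r), u ψ ≤
      ∫⁻ ψ, ENNReal.ofReal (diskPoisson r (θ - ψ)) * u ψ := by
  rw [← lintegral_const_mul' _ _ ENNReal.ofReal_ne_top]
  refine (setLIntegral_mono' measurableSet_closedBall fun ψ hψ => ?_).trans
    (setLIntegral_le_lintegral (closedBall θ (1 - r)) _)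
  gcongr
  exact inv_le_diskPoisson hr (by rwa [mem_closedBall', dist_eq_norm] at hψ)

theorem lintegral_mul_sub_left (F u : Torus → ℝ≥0∞) (θ : Torus) :
    ∫⁻ φ, F φ * u (θ - φ) = ∫⁻ ψ, F (θ - ψ) * u ψ := by
  rw [← lintegral_sub_left_eq_self (fun ψ => F (θ - ψ) * u ψ) θ]
  simp

theorem bddAbove_norm_diskPoisson (hr : r ∈ Ioo (0 : ℝ) 1) :
    BddAbove (range fun θ => ‖diskPoisson r θ‖) := by
  refine ⟨2 / (1 - r), ?_⟩
  rintro _ ⟨θ, rfl⟩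
  simp only [Real.norm_of_nonneg (diskPoisson_nonneg hr θ)]
  exact diskPoisson_le hr θ

theorem convolutionExists_diskPoisson (hr : r ∈ Ioo (0 : ℝ) 1) {f : Torus → ℂ}
    (hf : Integrable f) :
    ConvolutionExists (diskPoisson r) f (ContinuousLinearMap.lsmul ℝ ℝ) volume := by
  intro θ
  refine (hf.comp_sub_left θ).bdd_smul (2 / (1 - r))
    (continuous_diskPoisson hr).aestronglyMeasurable (Eventually.of_forall fun φ => ?_)
  rw [Real.norm_of_nonneg (diskPoisson_nonneg hr φ)]
  exact diskPoisson_le hr φ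

theorem integrable_of_convolutionExists_diskPoisson (hr : r ∈ Ioo (0 : ℝ) 1) {f : Torus → ℂ}
    (hf : AEStronglyMeasurable f)
    (h : ConvolutionExists (diskPoisson r) f (ContinuousLinearMap.lsmul ℝ ℝ) volume) :
    Integrable f := by
  have h0 : Integrable fun φ : Torus => diskPoisson r φ • f (0 - φ) := h 0
  have h1 : 0 < (1 - r) / (1 + r) := div_pos (sub_pos.2 hr.2) (by linarith [hr.1])
  have h2 : Integrable fun φ : Torus => f (0 - φ) := by
    refine (h0.norm.const_mul ((1 - r) / (1 + r))⁻¹).mono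
      (hf.comp_quasiMeasurePreserving (quasiMeasurePreserving_sub_left volume 0))
      (Eventually.of_forall fun φ => ?_)
    rw [Real.norm_of_nonneg (by positivity), norm_smul,
      Real.norm_of_nonneg (diskPoisson_nonneg hr φ), ← mul_assoc]
    refine le_mul_of_one_le_left (norm_nonneg _) ?_
    rw [inv_mul_eq_div, one_le_div h1]
    exact div_le_diskPoisson hr φ
  simpa using h2.comp_sub_left 0

/-- The supremum is uncountable, but each `P_r * f` is continuous, so it is lower semicontinuous. -/
theorem measurable_poissonMax {f : Torus → ℂ} (hf : Integrable f) :
    Measurable (poissonMax f) := by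
  refine LowerSemicontinuous.measurable ?_
  refine lowerSemicontinuous_biSup fun r hr => Continuous.lowerSemicontinuous ?_
  refine Continuous.enorm ?_
  have h : Continuous (diskPoisson r ⋆[ContinuousLinearMap.lsmul ℝ ℝ] f) :=
    (bddAbove_norm_diskPoisson hr).continuous_convolution_left_of_integrable _
      (continuous_diskPoisson hr) hf
  exact h.const_smul (2 * π)⁻¹

theorem poissonConv_eq (f : Torus → ℂ) (θ : Torus) :
    poissonConv r f θ = (2 * π)⁻¹ • ∫ φ, diskPoisson r φ • f (θ - φ) := rfl

theorem enorm_diskPoisson_smul (hr : r ∈ Ioo (0 : ℝ) 1) (φ : Torus) (z : ℂ) :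
    ‖diskPoisson r φ • z‖ₑ = ENNReal.ofReal (diskPoisson r φ) * ‖z‖ₑ := by
  rw [enorm_smul, Real.enorm_of_nonneg (diskPoisson_nonneg hr φ)]

theorem enorm_poissonConv_le (hr : r ∈ Ioo (0 : ℝ) 1) (f : Torus → ℂ) (θ : Torus) :
    ‖poissonConv r f θ‖ₑ ≤ ENNReal.ofReal (2 * π)⁻¹ *
      ∫⁻ ψ, ENNReal.ofReal (diskPoisson r (θ - ψ)) * ‖f ψ‖ₑ := by
  rw [← lintegral_mul_sub_left (fun φ => ENNReal.ofReal (diskPoisson r φ)) (fun ψ => ‖f ψ‖ₑ),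
    poissonConv_eq, enorm_smul, Real.enorm_of_nonneg (by positivity)]
  refine mul_le_mul_right ((enorm_integral_le_lintegral_enorm _).trans_eq ?_) _
  exact lintegral_congr fun φ => enorm_diskPoisson_smul hr φ _

/-- Without cancellation the triangle inequality is an equality. This is where nonnegativity of `f`
enters. -/
theorem enorm_poissonConv_of_nonneg (hr : r ∈ Ioo (0 : ℝ) 1) {f : Torus → ℂ}
    (hf : Integrable f) (hf0 : ∀ᵐ θ, 0 ≤ f θ) (θ : Torus) :
    ‖poissonConv r f θ‖ₑ = ENNReal.ofReal (2 * π)⁻¹ *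
      ∫⁻ ψ, ENNReal.ofReal (diskPoisson r (θ - ψ)) * ‖f ψ‖ₑ := by
  rw [← lintegral_mul_sub_left (fun φ => ENNReal.ofReal (diskPoisson r φ)) (fun ψ => ‖f ψ‖ₑ),
    poissonConv_eq, enorm_smul, Real.enorm_of_nonneg (by positivity)]
  congr 1
  have hint : Integrable fun φ : Torus => diskPoisson r φ • f (θ - φ) :=
    convolutionExists_diskPoisson hr hf θ
  have hae : ∀ᵐ φ : Torus, 0 ≤ f (θ - φ) :=
    (quasiMeasurePreserving_sub_left volume θ).ae (p := fun ψ => 0 ≤ f ψ) hf0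
  have heq : ∫ φ, diskPoisson r φ • f (θ - φ) =
      ((∫ φ, ‖diskPoisson r φ • f (θ - φ)‖ : ℝ) : ℂ) := by
    rw [← integral_complex_ofReal]
    refine integral_congr_ae ?_
    filter_upwards [hae] with φ hφ
    rw [norm_smul, Real.norm_of_nonneg (diskPoisson_nonneg hr φ),
      Complex.ofReal_mul, Complex.real_smul, ← Complex.eq_coe_norm_of_nonneg hφ]
  rw [heq, ← ofReal_norm, Complex.norm_real,
    Real.norm_of_nonneg (integral_nonneg fun φ => norm_nonneg _),
    ofReal_integral_norm_eq_lintegral_enorm hint]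
  exact lintegral_congr fun φ => enorm_diskPoisson_smul hr φ _

end Poisson

/-! ### The Orlicz functions -/

theorem one_le_log_exp_one_add {t : ℝ} (ht : 0 ≤ t) : 1 ≤ Real.log (Real.exp 1 + t) := by
  rw [Real.le_log_iff_exp_le (by positivity)]
  linarith

theorem log_exp_one_add_pos {t : ℝ} (ht : 0 ≤ t) : 0 < Real.log (Real.exp 1 + t) :=
  one_pos.trans_le (one_le_log_exp_one_add ht)

theorem hasDerivAt_log_exp_one_add {t : ℝ} (ht : 0 ≤ t) :
    HasDerivAt (fun s => Real.log (Real.exp 1 + s)) (1 / (Real.exp 1 + t)) t :=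
  ((hasDerivAt_id t).const_add (Real.exp 1)).log (by positivity)

theorem continuousOn_log_exp_one_add :
    ContinuousOn (fun s => Real.log (Real.exp 1 + s)) (Ici 0) := fun _ ht =>
  (hasDerivAt_log_exp_one_add ht).continuousAt.continuousWithinAt

/-- The real version of `psiZero`. -/
noncomputable def psiReal (t : ℝ) : ℝ := t / Real.log (Real.exp 1 + t)

/-- The derivative of `psiReal`. -/
noncomputable def psiDeriv (t : ℝ) : ℝ :=
  (1 * Real.log (Real.exp 1 + t) - t * (1 / (Real.exp 1 + t))) / Real.log (Real.exp 1 + t) ^ 2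

theorem psiZero_of_ne_top {t : ℝ≥0∞} (ht : t ≠ ∞) :
    psiZero t = ENNReal.ofReal (psiReal t.toReal) := if_neg ht

theorem psiReal_mul_le {a t : ℝ} (ha : 1 ≤ a) (ht : 0 ≤ t) : psiReal (a * t) ≤ a * psiReal t := by
  rw [psiReal, psiReal, ← mul_div_assoc]
  have h := log_exp_one_add_pos ht
  gcongr
  exact le_mul_of_one_le_left ht ha

theorem hasDerivAt_psiReal {t : ℝ} (ht : 0 ≤ t) : HasDerivAt psiReal (psiDeriv t) t :=
  (hasDerivAt_id t).div (hasDerivAt_log_exp_one_add ht) (log_exp_one_add_pos ht).ne'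

theorem continuousOn_psiDeriv : ContinuousOn psiDeriv (Ici 0) := by
  have h := continuousOn_log_exp_one_add
  refine ContinuousOn.div ((continuousOn_const.mul h).sub (continuousOn_id.mul
    (continuousOn_const.div (by fun_prop) fun t ht => ?_))) (h.pow 2) fun t ht => ?_
  · have := Real.exp_pos 1
    have : 0 ≤ t := ht
    positivity
  · exact pow_ne_zero _ (log_exp_one_add_pos ht).ne'

theorem psiDeriv_le {t : ℝ} (ht : 0 ≤ t) : psiDeriv t ≤ 1 / Real.log (Real.exp 1 + t) := by
  have h := log_exp_one_add_pos ht
  rw [psiDeriv, div_le_div_iff₀ (by positivity) h]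
  have : 0 ≤ t * (1 / (Real.exp 1 + t)) := by positivity
  nlinarith

theorem le_psiDeriv {t : ℝ} (ht : 0 ≤ t) : 1 / Real.log (Real.exp 1 + t) ≤ 2 * psiDeriv t := by
  have h := log_exp_one_add_pos ht
  have he := Real.exp_pos 1
  set q := t * (1 / (Real.exp 1 + t)) with hq
  have hq1 : q ≤ 1 := by
    rw [hq, mul_one_div, div_le_one (by positivity)]
    linarith
  -- From `log x ≥ 1 - 1/x` at `x = (e + t) / e`. With `q ≤ 1` it gives `2q ≤ log (e + t)`, which is
  -- the claim after clearing denominators.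
  have h1 : 1 + q ≤ Real.log (Real.exp 1 + t) := by
    have h2 := Real.one_sub_inv_le_log_of_pos (show 0 < (Real.exp 1 + t) / Real.exp 1 by positivity)
    rw [Real.log_div (by positivity) he.ne', Real.log_exp] at h2
    have h3 : 1 - ((Real.exp 1 + t) / Real.exp 1)⁻¹ = q := by rw [hq]; field_simp; ring
    linarith
  rw [psiDeriv, ← hq, ← mul_div_assoc, div_le_div_iff₀ h (by positivity)]
  nlinarith

theorem psiDeriv_nonneg {t : ℝ} (ht : 0 ≤ t) : 0 ≤ psiDeriv t := by
  have h1 := le_psiDeriv ht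
  have h2 := one_div_pos.2 (log_exp_one_add_pos ht)
  linarith

/-- The function `log log (e + t)`. -/
noncomputable def logLog (t : ℝ) : ℝ := Real.log (Real.log (Real.exp 1 + t))

/-- The derivative of `logLog`. -/
noncomputable def logLogDeriv (t : ℝ) : ℝ := 1 / (Real.exp 1 + t) / Real.log (Real.exp 1 + t)

theorem hasDerivAt_logLog {t : ℝ} (ht : 0 ≤ t) : HasDerivAt logLog (logLogDeriv t) t :=
  (hasDerivAt_log_exp_one_add ht).log (log_exp_one_add_pos ht).ne'

theorem continuousOn_logLogDeriv : ContinuousOn logLogDeriv (Ici 0) := by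
  refine ContinuousOn.div (continuousOn_const.div (by fun_prop) fun t ht => ?_)
    continuousOn_log_exp_one_add fun t ht => (log_exp_one_add_pos ht).ne'
  have := Real.exp_pos 1
  have : 0 ≤ t := ht
  positivity

theorem logLogDeriv_nonneg {t : ℝ} (ht : 0 ≤ t) : 0 ≤ logLogDeriv t :=
  div_nonneg (by positivity) (log_exp_one_add_pos ht).le

theorem logLogDeriv_le_one {t : ℝ} (ht : 0 ≤ t) : logLogDeriv t ≤ 1 := by
  have h1 := one_le_log_exp_one_add ht
  have h2 : 1 / (Real.exp 1 + t) ≤ 1 := by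
    rw [div_le_one (by positivity)]
    linarith [Real.add_one_le_exp 1]
  exact (div_le_one (by linarith)).2 (h2.trans h1)

/-- This bound and the next are the link between `Ψ₀` and `log log`: both sides are of order `1 /
log (e + t)` for `t ≥ 1`. The converse needs `t` away from `0`, where `t * logLogDeriv t` vanishes.
-/
theorem mul_logLogDeriv_le {t : ℝ} (ht : 0 ≤ t) : t * logLogDeriv t ≤ 2 * psiDeriv t := by
  refine le_trans ?_ (le_psiDeriv ht)
  have h := log_exp_one_add_pos ht
  rw [logLogDeriv, ← mul_div_assoc]
  gcongr
  rw [mul_one_div, div_le_one (by positivity)]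
  linarith [Real.exp_pos 1]

theorem psiDeriv_le_mul_logLogDeriv {t : ℝ} (ht : 1 ≤ t) :
    psiDeriv t ≤ (Real.exp 1 + 1) * t * logLogDeriv t := by
  have h0 : 0 ≤ t := by linarith
  refine (psiDeriv_le h0).trans ?_
  have h := log_exp_one_add_pos h0
  rw [logLogDeriv, ← mul_div_assoc]
  gcongr
  rw [mul_one_div, one_le_div (by positivity)]
  nlinarith [Real.exp_pos 1]

theorem logLog_nonneg {t : ℝ} (ht : 0 ≤ t) : 0 ≤ logLog t :=
  Real.log_nonneg (one_le_log_exp_one_add ht)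

theorem posLog_posLog_le_logLog {t : ℝ} (ht : 0 ≤ t) : Real.posLog (Real.posLog t) ≤ logLog t := by
  have h1 := one_le_log_exp_one_add ht
  have h2 : Real.posLog t ≤ Real.log (Real.exp 1 + t) := by
    refine max_le (by linarith) ?_
    rcases ht.eq_or_lt with rfl | h
    · simp
    · exact Real.log_le_log h (by linarith [Real.exp_pos 1])
  refine (Real.posLog_le_posLog Real.posLog_nonneg h2).trans_eq ?_
  exact Real.posLog_eq_log (by rwa [abs_of_nonneg (by linarith)])

/-- Constant factors inside `log log` cost only an additive constant, harmless against the finite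
measure `ν`. It follows from `e + at ≤ (e + a) max(1, t)` and bounding a sum by twice its larger
term. -/
theorem logLog_mul_le {a t : ℝ} (ha : 0 ≤ a) (ht : 0 ≤ t) :
    logLog (a * t) ≤ Real.log 2 + logLog a + Real.posLog (Real.posLog t) := by
  have he := Real.exp_pos 1
  have hLa := one_le_log_exp_one_add ha
  have hp : 0 ≤ Real.posLog t := Real.posLog_nonneg
  have h1 : Real.log (Real.exp 1 + a * t) ≤ Real.log (Real.exp 1 + a) + Real.posLog t := by
    have hm : 0 < max 1 t := lt_max_of_lt_left one_pos
    have h2 : Real.exp 1 + a * t ≤ (Real.exp 1 + a) * max 1 t := by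
      nlinarith [le_max_left 1 t, le_max_right 1 t]
    have h3 : Real.log (max 1 t) = Real.posLog t := by
      rw [Real.posLog_eq_log_max_one ht]
    rw [← h3, ← Real.log_mul (by positivity) hm.ne']
    exact Real.log_le_log (by positivity) h2
  have hpos := log_exp_one_add_pos (mul_nonneg ha ht)
  rcases le_total (Real.posLog t) (Real.log (Real.exp 1 + a)) with h | h
  · have h4 : logLog (a * t) ≤ Real.log (2 * Real.log (Real.exp 1 + a)) :=
      Real.log_le_log hpos (by linarith)
    rw [Real.log_mul two_ne_zero (by linarith)] at h4
    have : 0 ≤ Real.posLog (Real.posLog t) := Real.posLog_nonneg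
    rw [← logLog] at h4
    linarith
  · have h4 : logLog (a * t) ≤ Real.log (2 * Real.posLog t) :=
      Real.log_le_log hpos (by linarith)
    rw [Real.log_mul two_ne_zero (by linarith)] at h4
    have : Real.log (Real.posLog t) ≤ Real.posLog (Real.posLog t) := le_max_right _ _
    linarith [logLog_nonneg ha]

/-! ### Layer cake formulas and tail integrals -/

section LayerCake

variable {α : Type*} [MeasurableSpace α]

/-- The layer cake formula for a primitive of a continuous function. -/
theorem lintegral_comp_eq_of_hasDerivAt (μ : Measure α) {h : α → ℝ} (hm : Measurable h)
    (h0 : ∀ x, 0 ≤ h x) {G G' : ℝ → ℝ} (hG : ∀ t, 0 ≤ t → HasDerivAt G (G' t) t)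
    (hG0 : G 0 = 0) (hc : ContinuousOn G' (Ici 0)) (hn : ∀ t, 0 ≤ t → 0 ≤ G' t) :
    ∫⁻ x, ENNReal.ofReal (G (h x)) ∂μ =
      ∫⁻ t in Ioi 0, μ {x | t < h x} * ENNReal.ofReal (G' t) := by
  have hint : ∀ t, 0 ≤ t → IntervalIntegrable G' volume 0 t := fun t ht =>
    (hc.mono (by rw [uIcc_of_le ht]; exact Icc_subset_Ici_self)).intervalIntegrable
  rw [← lintegral_comp_eq_lintegral_meas_lt_mul μ (Eventually.of_forall h0) hm.aemeasurable
    (fun t ht => hint t ht.le)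
    (ae_restrict_of_forall_mem measurableSet_Ioi fun t ht => hn t (le_of_lt ht))]
  refine lintegral_congr fun x => ?_
  rw [intervalIntegral.integral_eq_sub_of_hasDerivAt (fun t ht => hG t ?_) (hint _ (h0 x)), hG0,
    sub_zero]
  rw [uIcc_of_le (h0 x)] at ht
  exact ht.1

theorem lintegral_psiReal_eq (μ : Measure α) {h : α → ℝ} (hm : Measurable h)
    (h0 : ∀ x, 0 ≤ h x) : ∫⁻ x, ENNReal.ofReal (psiReal (h x)) ∂μ =
      ∫⁻ t in Ioi 0, μ {x | t < h x} * ENNReal.ofReal (psiDeriv t) :=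
  lintegral_comp_eq_of_hasDerivAt μ hm h0 (fun _ => hasDerivAt_psiReal) (by simp [psiReal])
    continuousOn_psiDeriv fun _ => psiDeriv_nonneg

theorem lintegral_logLog_eq (μ : Measure α) {h : α → ℝ} (hm : Measurable h)
    (h0 : ∀ x, 0 ≤ h x) : ∫⁻ x, ENNReal.ofReal (logLog (h x)) ∂μ =
      ∫⁻ t in Ioi 0, μ {x | t < h x} * ENNReal.ofReal (logLogDeriv t) :=
  lintegral_comp_eq_of_hasDerivAt μ hm h0 (fun _ => hasDerivAt_logLog) (by simp [logLog])
    continuousOn_logLogDeriv fun _ => logLogDeriv_nonneg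

/-- Comparison of weighted tail integrals, when the tails compare above a threshold. -/
theorem setLIntegral_Ioi_le_of_le {A B : ℝ → ℝ≥0∞} {M : ℝ≥0∞} {a : ℝ}
    (hle : ∀ t, 0 < t → t ≤ a → A t ≤ M) (hgt : ∀ t, 0 < t → a < t → A t ≤ B t) :
    ∫⁻ t in Ioi 0, A t ≤ M * ENNReal.ofReal a + ∫⁻ t in Ioi 0, B t := by
  calc ∫⁻ t in Ioi 0, A t ≤ ∫⁻ t in Ioi 0, ((Iic a).indicator (fun _ => M) t + B t) := by
        refine setLIntegral_mono' measurableSet_Ioi fun t ht => ?_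
        rcases le_or_gt t a with h | h
        · rw [indicator_of_mem (mem_Iic.2 h)]
          exact (hle t ht h).trans le_self_add
        · exact (hgt t ht h).trans le_add_self
    _ = M * ENNReal.ofReal a + ∫⁻ t in Ioi 0, B t := by
        rw [lintegral_add_left (measurable_const.indicator measurableSet_Iic),
          lintegral_indicator measurableSet_Iic, setLIntegral_const,
          Measure.restrict_apply measurableSet_Iic, inter_comm, Ioi_inter_Iic, Real.volume_Ioc,
          sub_zero]

end LayerCake

/-! ### Distributional inequalities for the Poisson maximal function and the two inclusions -/

/-- The weak type inequality for the Poisson maximal function. -/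
theorem volume_poissonMax_gt_mul_le {f : Torus → ℂ} {g : Torus → ℝ} (hgm : Measurable g)
    (hfg : ∀ᵐ x, ‖f x‖ₑ = ENNReal.ofReal (g x)) (hfin : ∫⁻ x, ENNReal.ofReal (g x) ≠ ∞)
    {s : ℝ} (hs : 0 < s) :
    volume {x | ENNReal.ofReal s < poissonMax f x} * ENNReal.ofReal s ≤
      ENNReal.ofReal (640 * π) *
        volume.withDensity (fun x => ENNReal.ofReal (g x)) {x | s < 128 * π * g x} := by
  have hπ := Real.pi_pos
  have hu : Measurable fun x => ENNReal.ofReal (g x) := hgm.ennreal_ofReal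
  -- Averages at most `s / (64π)` give a Poisson integral at most `(2π)⁻¹ · 128π² · s / (64π) = s`.
  have hlam : 0 < s / (64 * π) := by positivity
  have hsub : {x | ENNReal.ofReal s < poissonMax f x} ⊆
      {x | ∃ ρ > 0, ENNReal.ofReal (s / (64 * π) * (2 * ρ)) <
        ∫⁻ y in closedBall x ρ, ENNReal.ofReal (g y)} := by
    intro x hx
    by_contra hcon
    simp only [mem_ofPred_eq, not_exists, not_and, not_lt] at hcon
    refine (not_le.2 hx) (iSup₂_le fun r hr => (enorm_poissonConv_le hr f x).trans ?_)
    have hcongr : ∫⁻ ψ, ENNReal.ofReal (diskPoisson r (x - ψ)) * ‖f ψ‖ₑ =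
        ∫⁻ ψ, ENNReal.ofReal (diskPoisson r (x - ψ)) * ENNReal.ofReal (g ψ) :=
      lintegral_congr_ae (hfg.mono fun ψ hψ => by simp only [hψ])
    rw [hcongr]
    refine (mul_le_mul_right (lintegral_diskPoisson_le hr hu hlam.le hcon) _).trans_eq ?_
    rw [← ENNReal.ofReal_mul (by positivity)]
    congr 1
    field_simp
    norm_num
  have hset : {x | ENNReal.ofReal (s / (64 * π) / 2) < ENNReal.ofReal (g x)} =
      {x | s < 128 * π * g x} := by
    ext x
    rw [mem_ofPred_eq, mem_ofPred_eq, ENNReal.ofReal_lt_ofReal_iff_of_nonneg (by positivity),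
      div_div, div_lt_iff₀ (by positivity)]
    ring_nf
  have h := volume_maximal_gt_mul_le_setLIntegral hu hfin hlam
  rw [hset, ← withDensity_apply _ (measurableSet_lt measurable_const (hgm.const_mul _))] at h
  calc _ ≤ volume {x | ∃ ρ > 0, ENNReal.ofReal (s / (64 * π) * (2 * ρ)) <
        ∫⁻ y in closedBall x ρ, ENNReal.ofReal (g y)} *
          ENNReal.ofReal (64 * π * (s / (64 * π))) := by
        rw [mul_div_cancel₀ _ (by positivity)]
        gcongr
    _ = ENNReal.ofReal (64 * π) * (volume {x | ∃ ρ > 0, ENNReal.ofReal (s / (64 * π) * (2 * ρ)) <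
        ∫⁻ y in closedBall x ρ, ENNReal.ofReal (g y)} * ENNReal.ofReal (s / (64 * π))) := by
        rw [ENNReal.ofReal_mul (by positivity)]; ring
    _ ≤ ENNReal.ofReal (64 * π) * (10 * volume.withDensity (fun x => ENNReal.ofReal (g x))
        {x | s < 128 * π * g x}) := by gcongr
    _ = _ := by
        rw [← mul_assoc, show (10 : ℝ≥0∞) = ENNReal.ofReal 10 by norm_num,
          ← ENNReal.ofReal_mul (by positivity)]
        ring_nf

theorem poissonMax_ae_ne_top {f : Torus → ℂ} {g : Torus → ℝ} (hgm : Measurable g)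
    (hfg : ∀ᵐ x, ‖f x‖ₑ = ENNReal.ofReal (g x)) (hfin : ∫⁻ x, ENNReal.ofReal (g x) ≠ ∞) :
    ∀ᵐ x, poissonMax f x ≠ ∞ := by
  set C := ENNReal.ofReal (640 * π) * ∫⁻ x, ENNReal.ofReal (g x) with hC
  have hCfin : C ≠ ∞ := ENNReal.mul_ne_top ENNReal.ofReal_ne_top hfin
  simp only [ae_iff, not_not, ne_eq]
  by_contra hne
  set v := volume {x | poissonMax f x = ∞} with hv
  have hle : ∀ s : ℝ, 0 < s → v * ENNReal.ofReal s ≤ C := by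
    intro s hs
    calc v * ENNReal.ofReal s ≤ volume {x | ENNReal.ofReal s < poissonMax f x} *
          ENNReal.ofReal s := by
          refine mul_le_mul_left (measure_mono fun x (hx : poissonMax f x = ∞) => ?_) _
          rw [mem_ofPred_eq, hx]
          exact ENNReal.ofReal_lt_top
      _ ≤ _ := volume_poissonMax_gt_mul_le hgm hfg hfin hs
      _ ≤ C := by
          rw [hC]
          gcongr
          refine (measure_mono (subset_univ _)).trans_eq ?_
          rw [withDensity_apply _ MeasurableSet.univ, Measure.restrict_univ]
  have hvfin : v ≠ ∞ := measure_ne_top _ _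
  have hvpos : 0 < v.toReal := ENNReal.toReal_pos hne hvfin
  -- This `s` makes the left side `C + 1`, a contradiction.
  have h := hle ((C.toReal + 1) / v.toReal) (by positivity)
  have h2 := ENNReal.toReal_mono hCfin h
  rw [ENNReal.toReal_mul, ENNReal.toReal_ofReal (by positivity),
    mul_div_cancel₀ _ hvpos.ne'] at h2
  linarith

/-- Membership in `L log log L` controls the Poisson maximal function. -/
theorem lintegral_psiZero_poissonMax_lt_top {f : Torus → ℂ} (hf : Integrable f) {g : Torus → ℝ}
    (hgm : Measurable g) (hg0 : ∀ x, 0 ≤ g x)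
    (hfg : ∀ᵐ x, ‖f x‖ₑ = ENNReal.ofReal (g x)) (hfin : ∫⁻ x, ENNReal.ofReal (g x) ≠ ∞)
    (hlog : ∫⁻ x, ENNReal.ofReal (g x * Real.posLog (Real.posLog (g x))) < ∞) :
    ∫⁻ x, psiZero (poissonMax f x) < ∞ := by
  have hπ := Real.pi_pos
  set ν : Measure Torus := volume.withDensity (fun x => ENNReal.ofReal (g x)) with hν
  have hpm := measurable_poissonMax hf
  have hne := poissonMax_ae_ne_top hgm hfg hfin
  set K : ℝ := 640 * π * (Real.exp 1 + 1) with hK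
  have hlogLog : ∫⁻ x, ENNReal.ofReal (logLog (128 * π * g x)) ∂ν < ∞ := by
    set c : ℝ := Real.log 2 + logLog (128 * π) with hc
    have hc0 : 0 ≤ c := add_nonneg (Real.log_nonneg one_le_two) (logLog_nonneg (by positivity))
    calc ∫⁻ x, ENNReal.ofReal (logLog (128 * π * g x)) ∂ν
        ≤ ∫⁻ x, ENNReal.ofReal (c + Real.posLog (Real.posLog (g x))) ∂ν :=
          lintegral_mono fun x => ENNReal.ofReal_le_ofReal
            (logLog_mul_le (by positivity) (hg0 x))
      _ = ∫⁻ x, (ENNReal.ofReal (g x) * ENNReal.ofReal c +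
            ENNReal.ofReal (g x * Real.posLog (Real.posLog (g x)))) := by
          have hm : Measurable fun x => ENNReal.ofReal (c + Real.posLog (Real.posLog (g x))) :=
            ((Real.continuous_posLog.measurable.comp
              (Real.continuous_posLog.measurable.comp hgm)).const_add c).ennreal_ofReal
          rw [hν, lintegral_withDensity_eq_lintegral_mul _ hgm.ennreal_ofReal hm]
          refine lintegral_congr fun x => ?_
          rw [Pi.mul_apply, ENNReal.ofReal_add hc0 Real.posLog_nonneg, mul_add,
            ENNReal.ofReal_mul (hg0 x)]
      _ < ∞ := by
          rw [lintegral_add_left (hgm.ennreal_ofReal.mul_const _),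
            lintegral_mul_const _ hgm.ennreal_ofReal]
          exact ENNReal.add_lt_top.2
            ⟨ENNReal.mul_lt_top hfin.lt_top ENNReal.ofReal_lt_top, hlog⟩
  calc ∫⁻ x, psiZero (poissonMax f x)
      = ∫⁻ x, ENNReal.ofReal (psiReal (poissonMax f x).toReal) :=
        lintegral_congr_ae (hne.mono fun x hx => psiZero_of_ne_top hx)
    _ = ∫⁻ t in Ioi 0, volume {x | t < (poissonMax f x).toReal} * ENNReal.ofReal (psiDeriv t) :=
        lintegral_psiReal_eq _ hpm.ennreal_toReal fun x => ENNReal.toReal_nonneg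
    -- Split at `t = 1`: below it `psiDeriv ≤ 1` on a finite measure space; above it `psiDeriv t ≲ t
    -- * logLogDeriv t`, and the factor `t` is absorbed by the weak type inequality.
    _ ≤ volume (univ : Set Torus) * ENNReal.ofReal 1 + ∫⁻ t in Ioi 0,
          ENNReal.ofReal K * (ν {x | t < 128 * π * g x} * ENNReal.ofReal (logLogDeriv t)) := by
        refine setLIntegral_Ioi_le_of_le (fun t ht _ => ?_) fun t ht ht1 => ?_
        · refine (mul_le_mul' (measure_mono (subset_univ _)) ?_).trans_eq (mul_one _)
          rw [ENNReal.ofReal_le_one]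
          refine (psiDeriv_le ht.le).trans ?_
          exact (div_le_one (log_exp_one_add_pos ht.le)).2 (one_le_log_exp_one_add ht.le)
        · have hw := volume_poissonMax_gt_mul_le hgm hfg hfin ht
          have hsub : volume {x | t < (poissonMax f x).toReal} ≤
              volume {x | ENNReal.ofReal t < poissonMax f x} :=
            measure_mono_ae (hne.mono fun x hx =>
              (ENNReal.ofReal_lt_iff_lt_toReal ht.le hx).2)
          have hd := logLogDeriv_nonneg ht.le
          calc volume {x | t < (poissonMax f x).toReal} * ENNReal.ofReal (psiDeriv t)
              ≤ volume {x | ENNReal.ofReal t < poissonMax f x} *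
                ENNReal.ofReal (t * ((Real.exp 1 + 1) * logLogDeriv t)) := by
                gcongr
                exact (psiDeriv_le_mul_logLogDeriv ht1.le).trans_eq (by ring)
            _ = volume {x | ENNReal.ofReal t < poissonMax f x} * ENNReal.ofReal t *
                ENNReal.ofReal ((Real.exp 1 + 1) * logLogDeriv t) := by
                rw [ENNReal.ofReal_mul ht.le, mul_assoc]
            _ ≤ ENNReal.ofReal (640 * π) * ν {x | t < 128 * π * g x} *
                ENNReal.ofReal ((Real.exp 1 + 1) * logLogDeriv t) := by gcongr
            _ = _ := by
                rw [hK, ENNReal.ofReal_mul (p := 640 * π) (by positivity),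
                  ENNReal.ofReal_mul (p := Real.exp 1 + 1) (by positivity)]
                ring
    _ = volume (univ : Set Torus) * ENNReal.ofReal 1 +
          ENNReal.ofReal K * ∫⁻ x, ENNReal.ofReal (logLog (128 * π * g x)) ∂ν := by
        rw [lintegral_const_mul' _ _ ENNReal.ofReal_ne_top,
          lintegral_logLog_eq ν (hgm.const_mul _) fun x => mul_nonneg (by positivity) (hg0 x)]
    _ < ∞ := ENNReal.add_lt_top.2
        ⟨ENNReal.mul_lt_top (measure_lt_top _ _) ENNReal.ofReal_lt_top,
          ENNReal.mul_lt_top ENNReal.ofReal_lt_top hlogLog⟩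

/-- For nonnegative functions, large values force the Poisson maximal function to be large. -/
theorem withDensity_gt_le_mul_volume_poissonMax {f : Torus → ℂ} (hf : Integrable f)
    (hf0 : ∀ᵐ x, 0 ≤ f x) {g : Torus → ℝ} (hgm : Measurable g)
    (hfg : ∀ᵐ x, ‖f x‖ₑ = ENNReal.ofReal (g x)) (hfin : ∫⁻ x, ENNReal.ofReal (g x) ≠ ∞)
    {lam : ℝ} (hlam : 0 < lam)
    (hlarge : ∫⁻ x, ENNReal.ofReal (g x) ≤ ENNReal.ofReal (lam * (1 / 2))) :
    volume.withDensity (fun x => ENNReal.ofReal (g x)) {x | lam < g x} ≤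
      ENNReal.ofReal (5 * lam) * volume {x | ENNReal.ofReal (lam / (8 * π)) < poissonMax f x} := by
  have hπ := Real.pi_pos
  have h := withDensity_gt_le_mul_volume hgm.ennreal_ofReal hfin hlam
    (by linarith [Real.pi_gt_three] : (1 / 2 : ℝ) ≤ 2 * π) hlarge
  have hset : {x | ENNReal.ofReal lam < ENNReal.ofReal (g x)} = {x | lam < g x} := by
    ext x
    exact ENNReal.ofReal_lt_ofReal_iff_of_nonneg hlam.le
  rw [hset] at h
  refine h.trans (mul_le_mul_right (measure_mono ?_) _)
  rintro y ⟨ρ, hρ, hlt⟩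
  rw [mem_ofPred_eq]
  -- The choice `r = 1 - ρ` is allowed because the covering argument was run with radii below `1 /
  -- 2`.
  have hr : 1 - ρ ∈ Ioo (0 : ℝ) 1 := ⟨by linarith [hρ.2], by linarith [hρ.1]⟩
  have hρ0 := hρ.1
  have hlow := setLIntegral_le_lintegral_diskPoisson hr (fun x => ENNReal.ofReal (g x)) y
  rw [sub_sub_cancel] at hlow
  have hcongr : ∫⁻ ψ, ENNReal.ofReal (diskPoisson (1 - ρ) (y - ψ)) * ‖f ψ‖ₑ =
      ∫⁻ ψ, ENNReal.ofReal (diskPoisson (1 - ρ) (y - ψ)) * ENNReal.ofReal (g ψ) :=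
    lintegral_congr_ae (hfg.mono fun ψ hψ => by simp only [hψ])
  -- The kernel bound yields `lam / (4π)`; the weaker `8π` makes the inequality strict.
  calc ENNReal.ofReal (lam / (8 * π)) < ENNReal.ofReal (lam / (4 * π)) := by
        rw [ENNReal.ofReal_lt_ofReal_iff (by positivity)]
        gcongr
        norm_num
    _ = ENNReal.ofReal (2 * π)⁻¹ * (ENNReal.ofReal (1 / (2 * ρ)) * ENNReal.ofReal (lam * ρ)) := by
        rw [← ENNReal.ofReal_mul (by positivity), ← ENNReal.ofReal_mul (by positivity)]
        congr 1
        field_simp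
        norm_num
    _ ≤ ENNReal.ofReal (2 * π)⁻¹ * (ENNReal.ofReal (1 / (2 * ρ)) *
          ∫⁻ ψ in closedBall y ρ, ENNReal.ofReal (g ψ)) := by gcongr
    _ ≤ ENNReal.ofReal (2 * π)⁻¹ *
          ∫⁻ ψ, ENNReal.ofReal (diskPoisson (1 - ρ) (y - ψ)) * ENNReal.ofReal (g ψ) := by gcongr
    _ = ‖poissonConv (1 - ρ) f y‖ₑ := by rw [enorm_poissonConv_of_nonneg hr hf hf0, hcongr]
    _ ≤ poissonMax f y := le_iSup₂ (f := fun r (_ : r ∈ Ioo (0 : ℝ) 1) => ‖poissonConv r f y‖ₑ) _ hr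

/-- For nonnegative functions, the Poisson maximal function controls `L log log L`. -/
theorem lintegral_posLog_posLog_lt_top {f : Torus → ℂ} (hf : Integrable f)
    (hf0 : ∀ᵐ x, 0 ≤ f x) {g : Torus → ℝ} (hgm : Measurable g) (hg0 : ∀ x, 0 ≤ g x)
    (hfg : ∀ᵐ x, ‖f x‖ₑ = ENNReal.ofReal (g x)) (hfin : ∫⁻ x, ENNReal.ofReal (g x) ≠ ∞)
    (hpsi : ∫⁻ x, psiZero (poissonMax f x) < ∞) :
    ∫⁻ x, ENNReal.ofReal (g x * Real.posLog (Real.posLog (g x))) < ∞ := by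
  have hπ := Real.pi_pos
  have h8π : 1 ≤ 8 * π := by linarith [Real.pi_gt_three]
  set ν : Measure Torus := volume.withDensity (fun x => ENNReal.ofReal (g x)) with hν
  have hpm := measurable_poissonMax hf
  have hne := poissonMax_ae_ne_top hgm hfg hfin
  set I := ∫⁻ x, ENNReal.ofReal (g x) with hI
  have hνuniv : ν univ = I := by
    rw [hν, withDensity_apply _ MeasurableSet.univ, Measure.restrict_univ]
  have hm : Measurable fun x => ENNReal.ofReal (logLog (g x)) := by
    unfold logLog
    fun_prop
  calc ∫⁻ x, ENNReal.ofReal (g x * Real.posLog (Real.posLog (g x)))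
      ≤ ∫⁻ x, ENNReal.ofReal (g x) * ENNReal.ofReal (logLog (g x)) := by
        refine lintegral_mono fun x => ?_
        rw [← ENNReal.ofReal_mul (hg0 x)]
        exact ENNReal.ofReal_le_ofReal
          (mul_le_mul_of_nonneg_left (posLog_posLog_le_logLog (hg0 x)) (hg0 x))
    _ = ∫⁻ x, ENNReal.ofReal (logLog (g x)) ∂ν := by
        rw [hν, lintegral_withDensity_eq_lintegral_mul _ hgm.ennreal_ofReal hm]
        rfl
    _ = ∫⁻ t in Ioi 0, ν {x | t < g x} * ENNReal.ofReal (logLogDeriv t) :=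
        lintegral_logLog_eq ν hgm hg0
    -- The reverse inequality requires `I ≤ t / 2`, hence the split at `t = 2I`.
    _ ≤ I * ENNReal.ofReal (2 * I.toReal) + ∫⁻ t in Ioi 0, ENNReal.ofReal 10 *
          (volume {x | t < 8 * π * (poissonMax f x).toReal} * ENNReal.ofReal (psiDeriv t)) := by
        refine setLIntegral_Ioi_le_of_le (fun t ht _ => ?_) fun t ht hlt => ?_
        · rw [← hνuniv]
          refine (mul_le_mul' (measure_mono (subset_univ _)) ?_).trans_eq (mul_one _)
          exact ENNReal.ofReal_le_one.2 (logLogDeriv_le_one ht.le)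
        · have hlarge : I ≤ ENNReal.ofReal (t * (1 / 2)) := by
            rw [← ENNReal.ofReal_toReal hfin]
            exact ENNReal.ofReal_le_ofReal (by linarith)
          have hsub : volume {x | ENNReal.ofReal (t / (8 * π)) < poissonMax f x} ≤
              volume {x | t < 8 * π * (poissonMax f x).toReal} := by
            refine measure_mono_ae (hne.mono fun x hx hlt' => ?_)
            have h1 := (ENNReal.ofReal_lt_iff_lt_toReal (by positivity) hx).1 hlt'
            exact (div_lt_iff₀' (by positivity)).1 h1
          calc ν {x | t < g x} * ENNReal.ofReal (logLogDeriv t)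
              ≤ ENNReal.ofReal (5 * t) * volume {x | t < 8 * π * (poissonMax f x).toReal} *
                ENNReal.ofReal (logLogDeriv t) := by
                gcongr
                exact (withDensity_gt_le_mul_volume_poissonMax hf hf0 hgm hfg hfin ht hlarge).trans
                  (mul_le_mul_right hsub _)
            _ = volume {x | t < 8 * π * (poissonMax f x).toReal} *
                ENNReal.ofReal (5 * (t * logLogDeriv t)) := by
                rw [← mul_assoc 5, ENNReal.ofReal_mul (p := 5 * t) (by positivity)]
                ring
            _ ≤ volume {x | t < 8 * π * (poissonMax f x).toReal} *
                ENNReal.ofReal (10 * psiDeriv t) := by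
                refine mul_le_mul_right (ENNReal.ofReal_le_ofReal ?_) _
                linarith [mul_logLogDeriv_le ht.le]
            _ = _ := by
                rw [ENNReal.ofReal_mul (by norm_num)]
                ring
    _ = I * ENNReal.ofReal (2 * I.toReal) + ENNReal.ofReal 10 *
          ∫⁻ x, ENNReal.ofReal (psiReal (8 * π * (poissonMax f x).toReal)) := by
        rw [lintegral_const_mul' _ _ ENNReal.ofReal_ne_top,
          lintegral_psiReal_eq _ (hpm.ennreal_toReal.const_mul _)
            fun x => mul_nonneg (by positivity) ENNReal.toReal_nonneg]
    _ ≤ I * ENNReal.ofReal (2 * I.toReal) + ENNReal.ofReal 10 *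
          (ENNReal.ofReal (8 * π) * ∫⁻ x, psiZero (poissonMax f x)) := by
        gcongr
        rw [← lintegral_const_mul' _ _ ENNReal.ofReal_ne_top]
        refine lintegral_mono_ae (hne.mono fun x hx => ?_)
        rw [psiZero_of_ne_top hx, ← ENNReal.ofReal_mul (by positivity)]
        exact ENNReal.ofReal_le_ofReal (psiReal_mul_le h8π ENNReal.toReal_nonneg)
    _ < ∞ := ENNReal.add_lt_top.2
        ⟨ENNReal.mul_lt_top hfin.lt_top ENNReal.ofReal_lt_top,
          ENNReal.mul_lt_top ENNReal.ofReal_lt_top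
            (ENNReal.mul_lt_top ENNReal.ofReal_lt_top hpsi)⟩

/-- An almost everywhere nonnegative integrable function is in `L log log L` exactly when
`Ψ₀` of its Poisson maximal function is integrable. -/
theorem lintegral_posLog_posLog_lt_top_iff {f : Torus → ℂ} (hf : Integrable f)
    (hf0 : ∀ᵐ x, 0 ≤ f x) :
    ∫⁻ θ, ENNReal.ofReal (‖f θ‖ * Real.posLog (Real.posLog ‖f θ‖)) < ∞ ↔
      ∫⁻ θ, psiZero (poissonMax f θ) < ∞ := by
  obtain ⟨f', hf'm, hff'⟩ := hf.aestronglyMeasurable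
  have hfg : ∀ᵐ x, ‖f x‖ₑ = ENNReal.ofReal ‖f' x‖ := by
    filter_upwards [hff'] with x hx
    rw [hx, ofReal_norm]
  have hfin : ∫⁻ x, ENNReal.ofReal ‖f' x‖ ≠ ∞ := by
    rw [← lintegral_congr_ae hfg]
    exact hf.2.ne
  have hcongr : ∫⁻ θ, ENNReal.ofReal (‖f θ‖ * Real.posLog (Real.posLog ‖f θ‖)) =
      ∫⁻ θ, ENNReal.ofReal (‖f' θ‖ * Real.posLog (Real.posLog ‖f' θ‖)) :=
    lintegral_congr_ae (hff'.mono fun x hx => by simp only [hx])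
  have hgm : Measurable fun x => ‖f' x‖ := hf'm.measurable.norm
  rw [hcongr]
  exact ⟨lintegral_psiZero_poissonMax_lt_top hf hgm (fun x => norm_nonneg _) hfg hfin,
    lintegral_posLog_posLog_lt_top hf hf0 hgm (fun x => norm_nonneg _) hfg hfin⟩

end HardyLog

theorem mainTheorem4 :
    {f : HardyLog.Torus → ℂ | f ∈ HardyLog.LLogLogL ∧ ∀ᵐ θ, 0 ≤ f θ} =
      {f : HardyLog.Torus → ℂ | f ∈ HardyLog.HLog ∧ ∀ᵐ θ, 0 ≤ f θ} := by
  ext f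
  refine and_congr_left fun hf0 => ⟨fun hf => ?_, fun hf => ?_⟩
  · exact ⟨hf.1.aestronglyMeasurable,
      fun r hr => HardyLog.convolutionExists_diskPoisson hr hf.1,
      (HardyLog.lintegral_posLog_posLog_lt_top_iff hf.1 hf0).1 hf.2⟩
  · have hint : Integrable f := HardyLog.integrable_of_convolutionExists_diskPoisson
      (r := 1 / 2) (by norm_num) hf.1 (hf.2.1 _ (by norm_num))
    exact ⟨hint, (HardyLog.lintegral_posLog_posLog_lt_top_iff hint hf0).2 hf.2.2⟩
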